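/- For $n\ge 0$ let $\mathcal{S}_n$ be the set of permutations of $[n]=\{1,\dots,n\}$, and let $\mathcal{S}^B_n$ be the hyperoctahedral group of rank $n$, i.e. the set of permutations $\pi$ of $\{\pm1,\dots,\pm n\}$ with $\pi(-i)=-\pi(i)$ for all $i$. For $\pi$ in $\mathcal{S}_n$ or $\mathcal{S}^B_n$ put $$\mathrm{des}_A(\pi)=\#\{i\in\{1,\dots,n-1\}:\pi(i)>\pi(i+1)\},$$ and for $\pi\in\mathcal{S}^B_n$ put $$\mathrm{des}_B(\pi)=\#\{i\in\{0,\dots,n-1\}:\pi(i)>\pi(i+1)\},\qquad \pi(0)=0.$$ Define polynomials in $\mathbb{Z}[x]$ by $$A_n(x)=\sum_{\pi\in\mathcal{S}_n}x^{\mathrm{des}_A(\pi)},\qquad B_n(x)=\sum_{\pi\in\mathcal{S}^B_n}x^{\mathrm{des}_B(\pi)}\qquad(n\ge 0),$$ $$C_n^E(x)=\sum_{\pi\in\mathcal{S}^B_n,\ \pi(1)>0}x^{\mathrm{des}_A(\pi)},\qquad C_n^O(x)=\sum_{\pi\in\mathcal{S}^B_n,\ \pi(1)<0}x^{\mathrm{des}_A(\pi)}\qquad(n\ge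 1),$$ and $C_0^E(x)=1$, $C_0^O(x)=0$. Then, for every integer $n\ge 0$, $$2^nA_n(x)=\sum_{k=0}^n\binom{n}{k}A_k(x)\,C_{n-k}^E(x)$$ and $$B_n(x)=A_n(x)+x\sum_{k=0}^{n-1}\binom{n}{k}A_k(x)\,C_{n-k}^O(x).$$ -/

import Mathlib

open Polynomial

/-- The number of descents of the word `w 1, w 2, …, w n`, that is, the number of
`i ∈ {1, …, n - 1}` with `w i > w (i + 1)`. -/
def desA (n : ℕ) (w : ℕ → ℤ) : ℕ :=
  ((Finset.Icc 1 (n - 1)).filter fun i => w i > w (i + 1)).card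

/-- The number of type `B` descents of the word `w 1, w 2, …, w n`, preceded by `w 0`: the number
of `i ∈ {0, …, n - 1}` with `w i > w (i + 1)`. It is used for words with `w 0 = 0`. -/
def desB (n : ℕ) (w : ℕ → ℤ) : ℕ :=
  ((Finset.range n).filter fun i => w i > w (i + 1)).card

/-- The set `[n] = {1, …, n}`. -/
abbrev Brack (n : ℕ) : Type := {i : ℕ // i ∈ Finset.Icc 1 n}

/-- The word `π(1) π(2) ⋯ π(n)` of a permutation of `[n]`, continued by `0` outside `[n]`. -/
def permWord {n : ℕ} (π : Equiv.Perm (Brack n)) (i : ℕ) : ℤ :=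
  if h : i ∈ Finset.Icc 1 n then ((π ⟨i, h⟩ : ℕ) : ℤ) else 0

/-- The set `±[n] = {±1, …, ±n}`. -/
abbrev SignedBrack (n : ℕ) : Type := {i : ℤ // i ∈ (Finset.Icc (-(n : ℤ)) n).erase 0}

/-- Negation on `±[n]`. -/
instance signedBrackNeg (n : ℕ) : Neg (SignedBrack n) where
  neg i := ⟨-i.1, by
    have h := i.2
    simp only [Finset.mem_erase, Finset.mem_Icc] at h ⊢
    omega⟩

/-- The hyperoctahedral group of rank `n`: the permutations `π` of `±[n]` such that
`π(-i) = -π(i)` for all `i`. -/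
abbrev SignedPerm (n : ℕ) : Type :=
  {π : Equiv.Perm (SignedBrack n) // ∀ i, π (-i) = -π i}

/-- The word `π(1) π(2) ⋯ π(n)` of a signed permutation, continued by `0` outside `[n]`;
in particular `π(0) = 0`. -/
def signedWord {n : ℕ} (π : SignedPerm n) (i : ℕ) : ℤ :=
  if h : i ∈ Finset.Icc 1 n then
    (π.1 ⟨(i : ℤ), by
      simp only [Finset.mem_erase, Finset.mem_Icc] at h ⊢
      omega⟩ : ℤ)
  else 0

/-- The type `A` Eulerian polynomial `A_n(x)`. -/
noncomputable def eulerianA (n : ℕ) : ℤ[X] :=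
  ∑ π : Equiv.Perm (Brack n), X ^ desA n (permWord π)

/-- The type `B` Eulerian polynomial `B_n(x)`. -/
noncomputable def eulerianB (n : ℕ) : ℤ[X] :=
  ∑ π : SignedPerm n, X ^ desB n (signedWord π)

/-- `C_n^E(x)`: the sum of `x ^ des_A(π)` over the signed permutations that do not start with a
negative letter. For `n ≥ 1` this means `π(1) > 0`; for `n = 0` the empty signed permutation is
counted here, so that `C_0^E(x) = 1`. -/
noncomputable def flagE (n : ℕ) : ℤ[X] :=
  ∑ π : SignedPerm n with ¬ signedWord π 1 < 0, X ^ desA n (signedWord π)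

/-- `C_n^O(x)`: the sum of `x ^ des_A(π)` over the signed permutations with `π(1) < 0`
(so that `C_0^O(x) = 0`). -/
noncomputable def flagO (n : ℕ) : ℤ[X] :=
  ∑ π : SignedPerm n with signedWord π 1 < 0, X ^ desA n (signedWord π)

/-! Both identities come from cutting signed words. Replace permutations by their one-line words.
The descent number depends only on the relative order of the letters, so the arrangements of any set
of `k` integers have descent polynomial `A_k` (`sum_arrangements`). The signed arrangements of a set
of `n` positive integers split according to which letters are positive. Each of the `2 ^ n` choices
leaves the arrangements of a set of `n` integers, so the total is `2 ^ n A_n`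
(`sum_signedArrangements`).

For the first identity, cut each signed word after its longest initial run of negative letters. The
run is an arrangement of `-T` for some `T`, and the rest is a signed arrangement of the complement
of `T` that does not start with a negative letter. The cut is never a descent, so descents add and
the term is `A_k C^E_{n-k}` with `k = |T|`. Grouping the sets `T` by size gives the binomial
coefficients.

For the second, put `0` in front and cut after the longest initial run of positive letters. A
nonempty rest starts with a negative letter, so the cut is exactly one descent; this is the factor
`x`. An empty rest gives `A_n`. -/

/-! ### Descents of lists of integers -/

/-- The number of descents of a list of integers. -/
def listDes : List ℤ → ℕ
  | [] => 0
  | [_] => 0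
  | a :: b :: l => (if b < a then 1 else 0) + listDes (b :: l)

theorem listDes_map {f : ℤ → ℤ} : ∀ {l : List ℤ},
    (∀ a ∈ l, ∀ b ∈ l, (f b < f a ↔ b < a)) → listDes (l.map f) = listDes l
  | [], _ => rfl
  | [_], _ => rfl
  | a :: b :: l, h => by
    have ih := listDes_map (l := b :: l)
      fun x hx y hy => h x (List.mem_cons_of_mem _ hx) y (List.mem_cons_of_mem _ hy)
    simp only [List.map_cons, listDes] at ih ⊢
    rw [ih]
    simp [h a (by simp) b (by simp)]

/-- The junction goes from a negative letter to a nonnegative one, so it is not a descent. The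
default head `0` admits an empty `m`. -/
theorem listDes_append_of_neg : ∀ {l m : List ℤ}, (∀ a ∈ l, a < 0) → ¬ m.headD 0 < 0 →
    listDes (l ++ m) = listDes l + listDes m
  | [], m, _, _ => by simp [listDes]
  | [a], [], _, _ => by simp [listDes]
  | [a], b :: m, h, hm => by
    have := h a (by simp)
    simp only [List.headD_cons] at hm
    simp only [List.cons_append, List.nil_append, listDes]
    rw [if_neg (by omega)]
  | a :: b :: l, m, h, hm => by
    have ih := listDes_append_of_neg (l := b :: l) (m := m)
      (fun x hx => h x (List.mem_cons_of_mem _ hx)) hm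
    simp only [List.cons_append, listDes] at ih ⊢
    rw [ih, add_assoc]

theorem listDes_zero_cons_of_pos {l : List ℤ} (h : ∀ a ∈ l, 0 < a) :
    listDes (0 :: l) = listDes l := by
  cases l with
  | nil => rfl
  | cons a l =>
    have := h a (by simp)
    rw [listDes, if_neg (by omega), zero_add]

/-- The letter before `b` is nonnegative, so the junction is a descent. The leading `a` stands for
`π(0) = 0` at first and for a positive letter later in the induction; it also covers an empty `l`.
-/
theorem listDes_cons_append_cons {b : ℤ} (hb : b < 0) (m : List ℤ) :
    ∀ (l : List ℤ) (a : ℤ), 0 ≤ a → (∀ x ∈ l, 0 < x) →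
      listDes (a :: (l ++ b :: m)) = listDes (a :: l) + (1 + listDes (b :: m))
  | [], a, ha, _ => by
    simp only [List.nil_append, listDes]
    rw [if_pos (by omega), zero_add]
  | c :: l, a, _, h => by
    have ih := listDes_cons_append_cons hb m l c (h c (by simp)).le
      fun x hx => h x (List.mem_cons_of_mem _ hx)
    simp only [List.cons_append, listDes] at ih ⊢
    rw [ih, add_assoc]

theorem listDes_map_range (n : ℕ) (w : ℕ → ℤ) :
    listDes ((List.range (n + 1)).map w) = desB n w := by
  induction n generalizing w with
  | zero => simp [listDes, desB]
  | succ n ih =>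
    have h := ih (fun i => w (i + 1))
    rw [List.range_succ_eq_map] at h ⊢
    rw [List.range_succ_eq_map]
    simp only [List.map_cons, List.map_map, listDes, desB, Finset.card_filter,
      Finset.sum_range_succ', Function.comp_def, Nat.succ_eq_add_one, zero_add, gt_iff_lt]
      at h ⊢
    rw [h, add_comm]

/-- The list `w 1, …, w n`. -/
def wordList (n : ℕ) (w : ℕ → ℤ) : List ℤ := (List.range n).map fun i => w (i + 1)

@[simp] theorem length_wordList (n : ℕ) (w : ℕ → ℤ) : (wordList n w).length = n := by
  simp [wordList]

theorem listDes_wordList (n : ℕ) (w : ℕ → ℤ) : listDes (wordList n w) = desA n w := by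
  cases n with
  | zero => simp [wordList, listDes, desA]
  | succ n =>
    rw [wordList, listDes_map_range, desB, desA, Finset.card_filter, Finset.card_filter,
      Nat.add_sub_cancel, ← Finset.Ico_add_one_right_eq_Icc, Finset.sum_Ico_eq_sum_range]
    simp [add_comm 1]

theorem listDes_zero_cons_wordList (n : ℕ) (w : ℕ → ℤ) (h : w 0 = 0) :
    listDes (0 :: wordList n w) = desB n w := by
  rw [← listDes_map_range, List.range_succ_eq_map]
  simp [wordList, h, Function.comp_def]

/-! ### Arrangements of a finite set -/

/-- The arrangements of a finite set of integers. -/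
def arrangements (S : Finset ℤ) : Finset (List ℤ) := S.val.lists.toFinset

theorem mem_arrangements {S : Finset ℤ} {l : List ℤ} :
    l ∈ arrangements S ↔ S.val = (l : Multiset ℤ) :=
  Multiset.mem_toFinset.trans (Multiset.mem_lists_iff _ _)

theorem mem_arrangements_iff {S : Finset ℤ} {l : List ℤ} :
    l ∈ arrangements S ↔ l.Nodup ∧ l.toFinset = S := by
  rw [mem_arrangements]
  constructor
  · intro h
    have hn : l.Nodup := by
      rw [← Multiset.coe_nodup, ← h]
      exact S.nodup
    refine ⟨hn, Finset.val_injective ?_⟩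
    rw [List.toFinset_val, hn.dedup, h]
  · rintro ⟨hn, rfl⟩
    rw [List.toFinset_val, hn.dedup]

theorem mem_of_mem_arrangements {S : Finset ℤ} {l : List ℤ} (h : l ∈ arrangements S) {a : ℤ} :
    a ∈ l ↔ a ∈ S := by
  rw [← (mem_arrangements_iff.1 h).2, List.mem_toFinset]

theorem length_of_mem_arrangements {S : Finset ℤ} {l : List ℤ} (h : l ∈ arrangements S) :
    l.length = S.card := by
  obtain ⟨hn, rfl⟩ := mem_arrangements_iff.1 h
  rw [List.toFinset_card_of_nodup hn]

theorem mem_arrangements_of_length {S : Finset ℤ} {l : List ℤ} (hn : l.Nodup)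
    (hl : l.length = S.card) (h : ∀ a ∈ l, a ∈ S) : l ∈ arrangements S := by
  refine mem_arrangements_iff.2 ⟨hn, Finset.eq_of_subset_of_card_le ?_ ?_⟩
  · intro a ha
    exact h a (List.mem_toFinset.1 ha)
  · rw [List.toFinset_card_of_nodup hn, hl]

theorem map_mem_arrangements {S : Finset ℤ} {f : ℤ → ℤ} (hf : Set.InjOn f S) {l : List ℤ}
    (h : l ∈ arrangements S) : l.map f ∈ arrangements (S.image f) := by
  rw [mem_arrangements] at h ⊢
  rw [Finset.image_val_of_injOn hf, h, Multiset.map_coe]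

theorem sum_arrangements_image {M : Type*} [AddCommMonoid M] {S : Finset ℤ} {f : ℤ → ℤ}
    (hf : Set.InjOn f S) (F : List ℤ → M) :
    ∑ l ∈ arrangements (S.image f), F l = ∑ l ∈ arrangements S, F (l.map f) := by
  have hg : ∀ a ∈ S, Function.invFunOn f S (f a) = a := fun a ha => hf.leftInvOn_invFunOn ha
  have hgi : (S.image f).image (Function.invFunOn f S) = S := by
    rw [Finset.image_image]
    exact (Finset.image_congr fun a ha => hg a ha).trans Finset.image_id
  have hmap : ∀ l ∈ arrangements S, (l.map f).map (Function.invFunOn f S) = l := fun l hl => by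
    rw [List.map_map]
    exact (List.map_congr_left fun a ha => hg a ((mem_of_mem_arrangements hl).1 ha)).trans
      (List.map_id l)
  symm
  refine Finset.sum_nbij' (List.map f) (List.map (Function.invFunOn f S))
    (fun l hl => map_mem_arrangements hf hl) (fun l hl => ?_) hmap (fun l hl => ?_)
    (fun _ _ => rfl)
  · have hinj : Set.InjOn (Function.invFunOn f S) (S.image f) := by
      intro a ha b hb hab
      obtain ⟨a, ha', rfl⟩ := Finset.mem_image.1 ha
      obtain ⟨b, hb', rfl⟩ := Finset.mem_image.1 hb
      rw [hg a ha', hg b hb'] at hab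
      rw [hab]
    have h := map_mem_arrangements hinj hl
    rwa [hgi] at h
  · rw [List.map_map]
    refine (List.map_congr_left fun a ha => ?_).trans (List.map_id l)
    obtain ⟨a, ha', rfl⟩ := Finset.mem_image.1 ((mem_of_mem_arrangements hl).1 ha)
    simp [hg a ha']

/-! ### Standardization and permutations as words -/

/-- The number of elements of `S` that are at most `a`. -/
def rankIn (S : Finset ℤ) (a : ℤ) : ℤ := ((S.filter (· ≤ a)).card : ℤ)

theorem rankIn_lt {S : Finset ℤ} {a b : ℤ} (hb : b ∈ S) (h : a < b) :
    rankIn S a < rankIn S b := by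
  unfold rankIn
  refine Nat.cast_lt.2 (Finset.card_lt_card ?_)
  refine Finset.ssubset_iff_of_subset ?_ |>.2 ⟨b, by simp [hb], by simp [h]⟩
  intro x
  simp only [Finset.mem_filter]
  exact fun hx => ⟨hx.1, by omega⟩

theorem rankIn_lt_iff {S : Finset ℤ} {a b : ℤ} (ha : a ∈ S) (hb : b ∈ S) :
    rankIn S a < rankIn S b ↔ a < b := by
  refine ⟨fun h => ?_, rankIn_lt hb⟩
  rcases lt_trichotomy a b with h' | rfl | h'
  · exact h'
  · exact absurd h (lt_irrefl _)
  · exact absurd h (rankIn_lt ha h').not_gt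

theorem rankIn_injOn (S : Finset ℤ) : Set.InjOn (rankIn S) S := by
  intro a ha b hb h
  rcases lt_trichotomy a b with h' | rfl | h'
  · exact absurd h (rankIn_lt hb h').ne
  · rfl
  · exact absurd h (rankIn_lt ha h').ne'

theorem rankIn_pos {S : Finset ℤ} {a : ℤ} (ha : a ∈ S) : 0 < rankIn S a :=
  Nat.cast_pos.2 (Finset.card_pos.2 ⟨a, by simp [ha]⟩)

theorem image_rankIn (S : Finset ℤ) : S.image (rankIn S) = Finset.Icc (1 : ℤ) S.card := by
  refine Finset.eq_of_subset_of_card_le ?_ ?_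
  · intro x hx
    obtain ⟨a, ha, rfl⟩ := Finset.mem_image.1 hx
    have h1 := rankIn_pos ha
    have h2 : rankIn S a ≤ S.card := Nat.cast_le.2 (Finset.card_filter_le _ _)
    exact Finset.mem_Icc.2 ⟨h1, h2⟩
  · rw [Finset.card_image_of_injOn (rankIn_injOn S)]
    simp

theorem sum_perm_eq_sum_arrangements {M : Type*} [AddCommMonoid M] (n : ℕ) (F : List ℤ → M) :
    ∑ π : Equiv.Perm (Brack n), F (wordList n (permWord π)) =
      ∑ l ∈ arrangements (Finset.Icc (1 : ℤ) n), F l := by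
  have hw : ∀ (π : Equiv.Perm (Brack n)) (i : ℕ) (h : i ∈ Finset.Icc 1 n),
      permWord π i = ((π ⟨i, h⟩ : ℕ) : ℤ) := fun π i h => dif_pos h
  refine Finset.sum_nbij (fun π => wordList n (permWord π)) ?_ ?_ ?_ (fun _ _ => rfl)
  · intro π _
    refine mem_arrangements_of_length ?_ (by simp) ?_
    · refine List.Nodup.map_on ?_ List.nodup_range
      intro i hi j hj hij
      rw [List.mem_range] at hi hj
      rw [hw π (i + 1) (by simp; omega), hw π (j + 1) (by simp; omega)] at hij
      have := π.injective (Subtype.ext (Nat.cast_injective hij))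
      simpa using this
    · intro a ha
      obtain ⟨i, hi, rfl⟩ := List.mem_map.1 ha
      rw [List.mem_range] at hi
      rw [hw π (i + 1) (by simp; omega)]
      have := (π ⟨i + 1, by simp; omega⟩).2
      simp only [Finset.mem_Icc] at this ⊢
      omega
  · intro π _ σ _ h
    ext ⟨i, hi⟩
    have hi' := Finset.mem_Icc.1 hi
    have := List.map_inj_left.1 h (i - 1) (by rw [List.mem_range]; omega)
    simp only [Nat.sub_add_cancel hi'.1] at this
    rw [hw π i hi, hw σ i hi] at this
    exact_mod_cast this
  · intro l hl
    have hl : l ∈ arrangements _ := hl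
    have hlen : l.length = n := by simpa using length_of_mem_arrangements hl
    have hmem : ∀ (i : ℕ) (h : i < l.length), 1 ≤ l[i] ∧ l[i] ≤ n := fun i h =>
      Finset.mem_Icc.1 ((mem_of_mem_arrangements hl).1 (List.getElem_mem h))
    have hlt : ∀ i : Brack n, i.1 - 1 < l.length := fun i => by
      have := Finset.mem_Icc.1 i.2
      omega
    -- Positions in `[n]` start at `1` and list indices at `0`, hence `i - 1`.
    let f : Brack n → Brack n := fun i => ⟨(l[i.1 - 1]'(hlt i)).toNat, by
      have := hmem (i.1 - 1) (hlt i)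
      rw [Finset.mem_Icc]
      omega⟩
    have hf : Function.Injective f := by
      intro i j hij
      have h1 := hmem _ (hlt i)
      have h2 := hmem _ (hlt j)
      have h3 : (l[i.1 - 1]'(hlt i)).toNat = (l[j.1 - 1]'(hlt j)).toNat :=
        congrArg Subtype.val hij
      have h4 := ((mem_arrangements_iff.1 hl).1.getElem_inj_iff).1
        (show l[i.1 - 1]'(hlt i) = l[j.1 - 1]'(hlt j) by omega)
      have h5 := Finset.mem_Icc.1 i.2
      have h6 := Finset.mem_Icc.1 j.2
      exact Subtype.ext (by omega)
    refine ⟨Equiv.ofBijective f (Finite.injective_iff_bijective.1 hf),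
      Finset.mem_coe.2 (Finset.mem_univ _), ?_⟩
    refine List.ext_getElem (by simp [hlen]) fun i h1 h2 => ?_
    simp only [wordList, List.getElem_map, List.getElem_range]
    rw [hw _ (i + 1) (by simp; omega)]
    have := hmem i h2
    simp only [Equiv.ofBijective_apply, f, Nat.add_sub_cancel]
    omega

/-- Replacing each letter by its rank in `S` preserves descents and turns arrangements of `S` into
words of permutations. -/
theorem sum_arrangements (S : Finset ℤ) :
    ∑ l ∈ arrangements S, (X : ℤ[X]) ^ listDes l = eulerianA S.card := by
  have h := sum_perm_eq_sum_arrangements S.card fun l => (X : ℤ[X]) ^ listDes l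
  rw [← image_rankIn, sum_arrangements_image (rankIn_injOn S)] at h
  simp only [listDes_wordList] at h
  rw [eulerianA, h]
  refine Finset.sum_congr rfl fun l hl => ?_
  rw [listDes_map fun a ha b hb => rankIn_lt_iff ((mem_of_mem_arrangements hl).1 hb)
    ((mem_of_mem_arrangements hl).1 ha)]

/-! ### Signed arrangements -/

/-- The set obtained from `U` by negating the elements outside `T`. -/
def signedSet (U T : Finset ℤ) : Finset ℤ := T ∪ (U \ T).image Neg.neg

/-- The signed arrangements of a finite set of positive integers. -/
def signedArrangements (U : Finset ℤ) : Finset (List ℤ) :=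
  U.powerset.biUnion fun T => arrangements (signedSet U T)

/-- Recovers `T` from its signed set, so that distinct choices of signs give disjoint families of
words. -/
theorem signedSet_filter_pos {U T : Finset ℤ} (hU : ∀ a ∈ U, 0 < a) (hT : T ⊆ U) :
    (signedSet U T).filter (0 < ·) = T := by
  ext a
  simp only [signedSet, Finset.mem_filter, Finset.mem_union, Finset.mem_image, Finset.mem_sdiff]
  constructor
  · rintro ⟨h | ⟨b, ⟨hb, _⟩, rfl⟩, ha⟩
    · exact h
    · have := hU b hb
      omega
  · exact fun h => ⟨Or.inl h, hU a (hT h)⟩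

theorem image_abs_signedSet {U T : Finset ℤ} (hU : ∀ a ∈ U, 0 < a) (hT : T ⊆ U) :
    (signedSet U T).image abs = U := by
  have h1 : T.image abs = T :=
    (Finset.image_congr fun a ha => abs_of_pos (hU a (hT ha))).trans Finset.image_id
  have h2 : ((U \ T).image Neg.neg).image abs = U \ T := by
    rw [Finset.image_image]
    refine (Finset.image_congr fun a ha => ?_).trans Finset.image_id
    simp only [Function.comp_apply, abs_neg, id]
    exact abs_of_pos (hU a (Finset.mem_sdiff.1 ha).1)
  rw [signedSet, Finset.image_union, h1, h2, Finset.union_sdiff_of_subset hT]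

theorem card_signedSet {U T : Finset ℤ} (hU : ∀ a ∈ U, 0 < a) (hT : T ⊆ U) :
    (signedSet U T).card = U.card := by
  rw [signedSet, Finset.card_union_of_disjoint, Finset.card_image_of_injective _ neg_injective,
    add_comm, Finset.card_sdiff_add_card_eq_card hT]
  rw [Finset.disjoint_left]
  intro a ha ha'
  obtain ⟨b, hb, rfl⟩ := Finset.mem_image.1 ha'
  have := hU _ (hT ha)
  have := hU _ (Finset.mem_sdiff.1 hb).1
  omega

/-- The union over sign choices serves to count; this description by absolute values is the one
compatible with cutting words. -/
theorem mem_signedArrangements {U : Finset ℤ} (hU : ∀ a ∈ U, 0 < a) {l : List ℤ} :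
    l ∈ signedArrangements U ↔ l.map abs ∈ arrangements U := by
  rw [signedArrangements, Finset.mem_biUnion]
  constructor
  · rintro ⟨T, hT, hl⟩
    rw [Finset.mem_powerset] at hT
    have h := image_abs_signedSet hU hT
    refine h ▸ map_mem_arrangements ?_ hl
    exact Finset.card_image_iff.1 (by rw [h, card_signedSet hU hT])
  · intro h
    have hmem : ∀ a, a ∈ U ↔ ∃ b ∈ l, |b| = a := fun a => by
      rw [← mem_of_mem_arrangements h, List.mem_map]
    have hn := (mem_arrangements_iff.1 h).1
    have hinj : ∀ a ∈ l, ∀ b ∈ l, |a| = |b| → a = b := fun a ha b hb hab =>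
      List.inj_on_of_nodup_map hn ha hb hab
    refine ⟨l.toFinset.filter (0 < ·), ?_, mem_arrangements_iff.2 ⟨hn.of_map, ?_⟩⟩
    · rw [Finset.mem_powerset]
      intro a ha
      simp only [Finset.mem_filter, List.mem_toFinset] at ha
      exact (hmem a).2 ⟨a, ha.1, abs_of_pos ha.2⟩
    · ext a
      simp only [signedSet, Finset.mem_union, Finset.mem_filter, List.mem_toFinset,
        Finset.mem_image, Finset.mem_sdiff]
      constructor
      · intro ha
        have h1 := hU |a| ((hmem _).2 ⟨a, ha, rfl⟩)
        by_cases h0 : 0 < a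
        · exact Or.inl ⟨ha, h0⟩
        · have h2 : |a| = -a := abs_of_nonpos (by omega)
          refine Or.inr ⟨-a, ⟨(hmem _).2 ⟨a, ha, h2⟩, fun h3 => ?_⟩, neg_neg a⟩
          have := hinj a ha (-a) h3.1 (abs_neg a).symm
          omega
      · rintro (⟨ha, _⟩ | ⟨b, ⟨hb, hb'⟩, rfl⟩)
        · exact ha
        · obtain ⟨c, hc, hcb⟩ := (hmem b).1 hb
          have hbp := hU b hb
          rcases abs_choice c with h3 | h3
          · exact absurd ⟨(show c = b by omega) ▸ hc, hbp⟩ hb'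
          · exact (show c = -b by omega) ▸ hc

theorem sum_signedArrangements {U : Finset ℤ} (hU : ∀ a ∈ U, 0 < a) :
    ∑ l ∈ signedArrangements U, (X : ℤ[X]) ^ listDes l = 2 ^ U.card * eulerianA U.card := by
  rw [signedArrangements, Finset.sum_biUnion]
  · rw [Finset.sum_congr rfl fun T hT => (sum_arrangements _).trans
      (congrArg eulerianA (card_signedSet hU (Finset.mem_powerset.1 hT)))]
    simp
  · intro T hT T' hT' hne
    refine Finset.disjoint_left.2 fun l hl hl' => hne ?_
    rw [Finset.mem_coe, Finset.mem_powerset] at hT hT'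
    rw [← signedSet_filter_pos hU hT, ← signedSet_filter_pos hU hT',
      ← (mem_arrangements_iff.1 hl).2, ← (mem_arrangements_iff.1 hl').2]

theorem length_of_mem_signedArrangements {U : Finset ℤ} (hU : ∀ a ∈ U, 0 < a) {l : List ℤ}
    (h : l ∈ signedArrangements U) : l.length = U.card := by
  rw [← length_of_mem_arrangements ((mem_signedArrangements hU).1 h), List.length_map]

theorem abs_mem_of_mem_signedArrangements {U : Finset ℤ} (hU : ∀ a ∈ U, 0 < a) {l : List ℤ}
    (h : l ∈ signedArrangements U) {a : ℤ} (ha : a ∈ l) : |a| ∈ U :=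
  (mem_of_mem_arrangements ((mem_signedArrangements hU).1 h)).1 (List.mem_map_of_mem ha)

/-! ### Standardization of signed words -/

/-- The odd extension of `rankIn U`. -/
def signedRank (U : Finset ℤ) (a : ℤ) : ℤ := a.sign * rankIn U |a|

theorem signedRank_of_pos (U : Finset ℤ) {a : ℤ} (h : 0 < a) :
    signedRank U a = rankIn U |a| := by
  rw [signedRank, Int.sign_eq_one_of_pos h, one_mul]

theorem signedRank_of_neg (U : Finset ℤ) {a : ℤ} (h : a < 0) :
    signedRank U a = -rankIn U |a| := by
  rw [signedRank, Int.sign_eq_neg_one_of_neg h, neg_one_mul]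

theorem signedRank_neg_iff {U : Finset ℤ} {a : ℤ} (h : |a| ∈ U) :
    signedRank U a < 0 ↔ a < 0 := by
  have hp := rankIn_pos h
  rcases lt_trichotomy a 0 with h1 | rfl | h1
  · rw [signedRank_of_neg U h1]
    omega
  · simp [signedRank]
  · rw [signedRank_of_pos U h1]
    omega

theorem abs_signedRank {U : Finset ℤ} (hU : ∀ a ∈ U, 0 < a) {a : ℤ} (h : |a| ∈ U) :
    |signedRank U a| = rankIn U |a| := by
  rw [signedRank, abs_mul, Int.abs_sign_of_ne_zero (abs_pos.1 (hU _ h)),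
    one_mul, abs_of_pos (rankIn_pos h)]

theorem signedRank_lt {U : Finset ℤ} (hU : ∀ a ∈ U, 0 < a) {a b : ℤ} (ha : |a| ∈ U)
    (hb : |b| ∈ U) (h : a < b) : signedRank U a < signedRank U b := by
  have ha' := abs_pos.1 (hU _ ha)
  have hb' := abs_pos.1 (hU _ hb)
  have h1 := rankIn_pos ha
  have h2 := rankIn_pos hb
  rcases ha'.lt_or_gt with h3 | h3 <;> rcases hb'.lt_or_gt with h4 | h4
  · rw [signedRank_of_neg U h3, signedRank_of_neg U h4, neg_lt_neg_iff]
    refine rankIn_lt ha ?_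
    rw [abs_of_neg h3, abs_of_neg h4]
    omega
  · rw [signedRank_of_neg U h3, signedRank_of_pos U h4]
    omega
  · omega
  · rw [signedRank_of_pos U h3, signedRank_of_pos U h4]
    refine rankIn_lt hb ?_
    rw [abs_of_pos h3, abs_of_pos h4]
    exact h

theorem signedRank_lt_iff {U : Finset ℤ} (hU : ∀ a ∈ U, 0 < a) {a b : ℤ} (ha : |a| ∈ U)
    (hb : |b| ∈ U) : signedRank U a < signedRank U b ↔ a < b := by
  refine ⟨fun h => ?_, signedRank_lt hU ha hb⟩
  rcases lt_trichotomy a b with h' | rfl | h'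
  · exact h'
  · exact absurd h (lt_irrefl _)
  · exact absurd h (signedRank_lt hU hb ha h').not_gt

theorem exists_signedRank_eq {U : Finset ℤ} (hU : ∀ a ∈ U, 0 < a) {b : ℤ}
    (hb : |b| ∈ Finset.Icc (1 : ℤ) U.card) : ∃ a, |a| ∈ U ∧ signedRank U a = b := by
  rw [← image_rankIn] at hb
  obtain ⟨a, ha, hab⟩ := Finset.mem_image.1 hb
  have h1 := hU a ha
  have h2 : |a| = a := abs_of_pos h1
  rcases abs_choice b with h | h
  · refine ⟨a, h2.symm ▸ ha, ?_⟩
    rw [signedRank_of_pos U h1, h2, hab, h]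
  · refine ⟨-a, by rwa [abs_neg, h2], ?_⟩
    rw [signedRank_of_neg U (by omega), abs_neg, h2, hab, h, neg_neg]

theorem pos_of_mem_Icc_one {n : ℤ} : ∀ a ∈ Finset.Icc 1 n, 0 < a := fun a h => by
  have := Finset.mem_Icc.1 h
  omega

/-- Ranking absolute values and keeping signs preserves both the order and the sign of the first
letter; ranking the signed letters themselves would lose the sign. -/
theorem sum_signedArrangements_map_signedRank {M : Type*} [AddCommMonoid M] {U : Finset ℤ}
    (hU : ∀ a ∈ U, 0 < a) (F : List ℤ → M) :
    ∑ l ∈ signedArrangements U, F (l.map (signedRank U)) =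
      ∑ l ∈ signedArrangements (Finset.Icc 1 (U.card : ℤ)), F l := by
  have hinj : ∀ a b, |a| ∈ U → |b| ∈ U → signedRank U a = signedRank U b → a = b := by
    intro a b ha hb h
    rcases lt_trichotomy a b with h' | h' | h'
    · exact absurd h (signedRank_lt hU ha hb h').ne
    · exact h'
    · exact absurd h (signedRank_lt hU hb ha h').ne'
  have hex : ∀ b : ℤ, ∃ a, |b| ∈ Finset.Icc (1 : ℤ) U.card → |a| ∈ U ∧ signedRank U a = b := by
    intro b
    by_cases hb : |b| ∈ Finset.Icc (1 : ℤ) U.card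
    · obtain ⟨a, ha⟩ := exists_signedRank_eq hU hb
      exact ⟨a, fun _ => ha⟩
    · exact ⟨0, fun h => absurd h hb⟩
  choose g hg using hex
  have habs : ∀ l ∈ signedArrangements U,
      (l.map (signedRank U)).map abs = (l.map abs).map (rankIn U) := fun l hl => by
    rw [List.map_map, List.map_map]
    exact List.map_congr_left fun a ha =>
      abs_signedRank hU (abs_mem_of_mem_signedArrangements hU hl ha)
  have hmem : ∀ l ∈ signedArrangements U,
      l.map (signedRank U) ∈ signedArrangements (Finset.Icc 1 (U.card : ℤ)) := fun l hl => by
    rw [mem_signedArrangements pos_of_mem_Icc_one, habs l hl, ← image_rankIn]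
    exact map_mem_arrangements (rankIn_injOn U) ((mem_signedArrangements hU).1 hl)
  have hright : ∀ m ∈ signedArrangements (Finset.Icc 1 (U.card : ℤ)),
      (m.map g).map (signedRank U) = m := fun m hm => by
    rw [List.map_map]
    exact (List.map_congr_left fun b hb =>
      (hg b (abs_mem_of_mem_signedArrangements pos_of_mem_Icc_one hm hb)).2).trans (List.map_id m)
  refine Finset.sum_nbij' (List.map (signedRank U)) (List.map g) hmem (fun m hm => ?_)
    (fun l hl => ?_) hright (fun _ _ => rfl)
  · have hm' : ∀ a ∈ m.map g, |a| ∈ U := by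
      intro a ha
      obtain ⟨b, hb, rfl⟩ := List.mem_map.1 ha
      exact (hg b (abs_mem_of_mem_signedArrangements pos_of_mem_Icc_one hm hb)).1
    -- Ranking the absolute values of `m.map g` returns those of `m`, which are distinct.
    have hn : (((m.map g).map abs).map (rankIn U)).Nodup := by
      have h : ((m.map g).map abs).map (rankIn U) = m.map abs := by
        rw [List.map_map]
        nth_rw 2 [← hright m hm]
        rw [List.map_map (f := signedRank U)]
        exact List.map_congr_left fun a ha => (abs_signedRank hU (hm' a ha)).symm
      rw [h]
      exact (mem_arrangements_iff.1 ((mem_signedArrangements pos_of_mem_Icc_one).1 hm)).1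
    rw [mem_signedArrangements hU]
    refine mem_arrangements_of_length hn.of_map ?_ ?_
    · simpa using length_of_mem_signedArrangements pos_of_mem_Icc_one hm
    · intro a ha
      obtain ⟨b, hb, rfl⟩ := List.mem_map.1 ha
      exact hm' b hb
  · rw [List.map_map]
    refine (List.map_congr_left fun a ha => ?_).trans (List.map_id l)
    have h1 := abs_mem_of_mem_signedArrangements hU hl ha
    have h2 := hg _ (abs_mem_of_mem_signedArrangements pos_of_mem_Icc_one (hmem l hl)
      (List.mem_map_of_mem ha))
    exact hinj _ _ h2.1 h1 h2.2

/-! ### Signed permutations as signed words -/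

theorem signedWord_apply {n : ℕ} (π : SignedPerm n) (i : SignedBrack n) :
    (π.1 i : ℤ) = (i : ℤ).sign * signedWord π (i : ℤ).natAbs := by
  have hi := i.2
  simp only [Finset.mem_erase, Finset.mem_Icc] at hi
  have hm : (i : ℤ).natAbs ∈ Finset.Icc 1 n := by
    rw [Finset.mem_Icc]
    omega
  rw [signedWord, dif_pos hm]
  rcases hi.1.lt_or_gt with h | h
  · rw [Int.sign_eq_neg_one_of_neg h, neg_one_mul]
    have h1 := congrArg Subtype.val (π.2 i)
    have h2 : (-i : SignedBrack n) = ⟨((i : ℤ).natAbs : ℤ), by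
        simp only [Finset.mem_erase, Finset.mem_Icc]
        omega⟩ := Subtype.ext (by
        change -(i : ℤ) = ((i : ℤ).natAbs : ℤ)
        omega)
    rw [h2] at h1
    rw [h1]
    exact (neg_neg _).symm
  · rw [Int.sign_eq_one_of_pos h, one_mul]
    congr 3
    exact Subtype.ext (by simp only; omega)

theorem sum_signedPerm_eq_sum_signedArrangements {M : Type*} [AddCommMonoid M] (n : ℕ)
    (F : List ℤ → M) :
    ∑ π : SignedPerm n, F (wordList n (signedWord π)) =
      ∑ l ∈ signedArrangements (Finset.Icc (1 : ℤ) n), F l := by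
  have hw : ∀ (π : SignedPerm n) (i : ℕ) (h : i ∈ Finset.Icc 1 n),
      signedWord π i = (π.1 ⟨(i : ℤ), by
        simp only [Finset.mem_erase, Finset.mem_Icc] at h ⊢
        omega⟩ : ℤ) := fun π i h => dif_pos h
  refine Finset.sum_nbij (fun π => wordList n (signedWord π)) ?_ ?_ ?_ (fun _ _ => rfl)
  · intro π _
    rw [mem_signedArrangements pos_of_mem_Icc_one]
    refine mem_arrangements_of_length ?_ (by simp) ?_
    · rw [wordList, List.map_map]
      refine List.Nodup.map_on ?_ List.nodup_range
      intro i hi j hj hij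
      rw [List.mem_range] at hi hj
      simp only [Function.comp_apply] at hij
      rw [hw π (i + 1) (by simp; omega), hw π (j + 1) (by simp; omega)] at hij
      rcases abs_eq_abs.1 hij with h | h
      · have := congrArg Subtype.val (π.1.injective (Subtype.ext h))
        simp only at this
        omega
      · have h' := (Subtype.ext h).trans (π.2 _).symm
        have := congrArg Subtype.val (π.1.injective h')
        have h2 : ((i + 1 : ℕ) : ℤ) = -((j + 1 : ℕ) : ℤ) := this
        omega
    · intro a ha
      obtain ⟨b, hb, rfl⟩ := List.mem_map.1 ha
      obtain ⟨i, hi, rfl⟩ := List.mem_map.1 hb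
      rw [List.mem_range] at hi
      rw [hw π (i + 1) (by simp; omega)]
      have := (π.1 ⟨((i + 1 : ℕ) : ℤ), by simp; omega⟩).2
      simp only [Finset.mem_Icc, Finset.mem_erase] at this ⊢
      exact ⟨Int.one_le_abs this.1, abs_le.2 this.2⟩
  · intro π _ σ _ h
    refine Subtype.ext (Equiv.ext fun i => Subtype.ext ?_)
    have hi := Finset.mem_erase.1 i.2
    have hi' := Finset.mem_Icc.1 hi.2
    have := List.map_inj_left.1 h ((i : ℤ).natAbs - 1) (by rw [List.mem_range]; omega)
    simp only [Nat.sub_add_cancel (show 1 ≤ (i : ℤ).natAbs by omega)] at this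
    rw [signedWord_apply, signedWord_apply, this]
  · intro l hl
    have hl : l ∈ signedArrangements _ := hl
    have hlen : l.length = n := by
      simpa using length_of_mem_signedArrangements pos_of_mem_Icc_one hl
    have hmem : ∀ (i : ℕ) (h : i < l.length), 1 ≤ |l[i]| ∧ |l[i]| ≤ n := fun i h =>
      Finset.mem_Icc.1 (abs_mem_of_mem_signedArrangements pos_of_mem_Icc_one hl
        (List.getElem_mem h))
    have hlt : ∀ i : SignedBrack n, (i : ℤ).natAbs - 1 < l.length := fun i => by
      have h := i.2
      simp only [Finset.mem_erase, Finset.mem_Icc] at h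
      omega
    have hsign : ∀ i : SignedBrack n, |(i : ℤ).sign| = 1 := fun i =>
      Int.abs_sign_of_ne_zero (Finset.mem_erase.1 i.2).1
    -- The odd extension of the word to `±[n]`.
    let f : SignedBrack n → SignedBrack n := fun i =>
      ⟨(i : ℤ).sign * l[(i : ℤ).natAbs - 1]'(hlt i), by
        have h1 := hmem _ (hlt i)
        have h0 : |(i : ℤ).sign * l[(i : ℤ).natAbs - 1]'(hlt i)| =
            |l[(i : ℤ).natAbs - 1]'(hlt i)| := by
          rw [abs_mul, hsign, one_mul]
        rw [← h0] at h1
        have h2 := abs_le.1 h1.2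
        rw [Finset.mem_erase, Finset.mem_Icc]
        refine ⟨fun h => ?_, h2⟩
        rw [h, abs_zero] at h1
        omega⟩
    have hf : Function.Injective f := by
      intro i j hij
      have h3 : (i : ℤ).sign * l[(i : ℤ).natAbs - 1]'(hlt i) =
        (j : ℤ).sign * l[(j : ℤ).natAbs - 1]'(hlt j) := congrArg Subtype.val hij
      have h4 : |l[(i : ℤ).natAbs - 1]'(hlt i)| = |l[(j : ℤ).natAbs - 1]'(hlt j)| := by
        have := congrArg abs h3
        rwa [abs_mul, abs_mul, hsign, hsign, one_mul, one_mul] at this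
      have hn := (mem_arrangements_iff.1 ((mem_signedArrangements pos_of_mem_Icc_one).1 hl)).1
      have h5 : (i : ℤ).natAbs - 1 = (j : ℤ).natAbs - 1 :=
        hn.getElem_inj_iff (hi := by simpa using hlt i) (hj := by simpa using hlt j) |>.1
          (by simpa using h4)
      have h6 := (Finset.mem_erase.1 i.2).1
      have h7 := (Finset.mem_erase.1 j.2).1
      have h8 : (i : ℤ).natAbs = (j : ℤ).natAbs := by omega
      have h9 := hmem _ (hlt j)
      -- The common letter is nonzero, so cancelling it shows that `i` and `j` have the same sign.
      have h10 : l[(j : ℤ).natAbs - 1]'(hlt j) ≠ 0 := fun h => by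
        rw [h] at h9
        simp at h9
      simp only [h8] at h3
      have h11 := mul_right_cancel₀ h10 h3
      refine Subtype.ext ?_
      rw [← Int.sign_mul_natAbs (i : ℤ), h11, h8, Int.sign_mul_natAbs]
    have hodd : ∀ i, f (-i) = -f i := by
      intro i
      refine Subtype.ext ?_
      have h1 : ((-i : SignedBrack n) : ℤ) = -(i : ℤ) := rfl
      have h2 : ((-f i : SignedBrack n) : ℤ) = -(f i : ℤ) := rfl
      rw [h2]
      simp only [f, h1, Int.sign_neg, Int.natAbs_neg, neg_mul]
    refine ⟨⟨Equiv.ofBijective f (Finite.injective_iff_bijective.1 hf), hodd⟩,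
      Finset.mem_coe.2 (Finset.mem_univ _), ?_⟩
    refine List.ext_getElem (by simp [hlen]) fun i h1 h2 => ?_
    simp only [wordList, List.getElem_map, List.getElem_range]
    rw [hw _ (i + 1) (by simp; omega)]
    simp only [Equiv.ofBijective_apply, f, Int.natAbs_natCast, Nat.add_sub_cancel]
    rw [Int.sign_eq_one_of_pos (by omega), one_mul]

/-- Keeping the sign condition as an argument of `G` yields the sums for `flagE` and `flagO` at
once. -/
theorem sum_signedArrangements_eq {M : Type*} [AddCommMonoid M] {U : Finset ℤ}
    (hU : ∀ a ∈ U, 0 < a) (G : ℕ → Prop → M) :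
    ∑ l ∈ signedArrangements U, G (listDes l) (l.headD 0 < 0) =
      ∑ π : SignedPerm U.card, G (desA U.card (signedWord π)) (signedWord π 1 < 0) := by
  have hhead : ∀ (n : ℕ) (π : SignedPerm n),
      (wordList n (signedWord π)).headD 0 = signedWord π 1 := by
    intro n π
    cases n with
    | zero => simp [wordList, signedWord]
    | succ n => simp [wordList, List.range_succ_eq_map]
  have h := sum_signedPerm_eq_sum_signedArrangements U.card
    fun l => G (listDes l) (l.headD 0 < 0)
  simp only [listDes_wordList, hhead] at h
  rw [h, ← sum_signedArrangements_map_signedRank hU]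
  refine Finset.sum_congr rfl fun l hl => ?_
  have hm := fun a => abs_mem_of_mem_signedArrangements hU hl (a := a)
  have h1 : (l.map (signedRank U)).headD 0 < 0 ↔ l.headD 0 < 0 := by
    cases l with
    | nil => rfl
    | cons a l => exact signedRank_neg_iff (hm a (by simp))
  rw [listDes_map fun a ha b hb => signedRank_lt_iff hU (hm b hb) (hm a ha), h1]

theorem sum_filter_not_neg {U : Finset ℤ} (hU : ∀ a ∈ U, 0 < a) :
    ∑ l ∈ signedArrangements U with ¬ l.headD 0 < 0, (X : ℤ[X]) ^ listDes l =
      flagE U.card := by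
  classical
  rw [flagE, Finset.sum_filter, Finset.sum_filter]
  convert sum_signedArrangements_eq hU fun d p => if ¬ p then (X : ℤ[X]) ^ d else 0

theorem sum_filter_neg {U : Finset ℤ} (hU : ∀ a ∈ U, 0 < a) :
    ∑ l ∈ signedArrangements U with l.headD 0 < 0, (X : ℤ[X]) ^ listDes l = flagO U.card := by
  classical
  rw [flagO, Finset.sum_filter, Finset.sum_filter]
  convert sum_signedArrangements_eq hU fun d p => if p then (X : ℤ[X]) ^ d else 0

/-! ### Cutting after the initial run of one sign -/

theorem not_headD_dropWhile (s : ℤ) :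
    ∀ l : List ℤ, ¬ 0 < s * (l.dropWhile fun a => decide (0 < s * a)).headD 0
  | [] => by simp
  | a :: l => by
    by_cases h : 0 < s * a
    · simpa [List.dropWhile_cons, h] using not_headD_dropWhile s l
    · simp [h]

/-- Uniqueness of the cut: a run of sign `s` followed by a rest that does not start with sign `s`
can be read off from the concatenation. -/
theorem takeWhile_dropWhile_append {s : ℤ} {l m : List ℤ} (hl : ∀ a ∈ l, 0 < s * a)
    (hm : ¬ 0 < s * m.headD 0) :
    (l ++ m).takeWhile (fun a => decide (0 < s * a)) = l ∧
      (l ++ m).dropWhile (fun a => decide (0 < s * a)) = m := by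
  have hl' : ∀ a ∈ l, decide (0 < s * a) = true := fun a ha => decide_eq_true (hl a ha)
  rw [List.takeWhile_append_of_pos hl', List.dropWhile_append_of_pos hl']
  cases m with
  | nil => simp
  | cons a m =>
    rw [List.headD_cons] at hm
    simp [hm]

theorem abs_eq_mul_of_pos {s a : ℤ} (hs : |s| = 1) (h : 0 < s * a) : |a| = s * a := by
  rw [← abs_of_pos h, abs_mul, hs, one_mul]

theorem mul_mul_cancel_of_abs_eq_one {s : ℤ} (hs : |s| = 1) (a : ℤ) : s * (s * a) = a := by
  rw [← mul_assoc, ← abs_mul_abs_self s, hs, one_mul, one_mul]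

theorem mem_arrangements_image_mul {s : ℤ} (hs : |s| = 1) {T : Finset ℤ}
    (hT : ∀ a ∈ T, 0 < a) {l : List ℤ} :
    l ∈ arrangements (T.image (s * ·)) ↔ l.map abs ∈ arrangements T ∧ ∀ a ∈ l, 0 < s * a := by
  have hc := mul_mul_cancel_of_abs_eq_one hs
  constructor
  · intro h
    have hpos : ∀ a ∈ l, 0 < s * a := by
      intro a ha
      obtain ⟨b, hb, rfl⟩ := Finset.mem_image.1 ((mem_of_mem_arrangements h).1 ha)
      rw [hc]
      exact hT b hb
    refine ⟨?_, hpos⟩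
    rw [List.map_congr_left fun a ha => abs_eq_mul_of_pos hs (hpos a ha)]
    have h1 := map_mem_arrangements (f := (s * ·)) (fun a _ b _ hab => by
      rw [← hc a, ← hc b]; exact congrArg (s * ·) hab) h
    have h2 : (T.image (s * ·)).image (s * ·) = T := by
      rw [Finset.image_image]
      exact (Finset.image_congr fun a _ => hc a).trans Finset.image_id
    rwa [h2] at h1
  · rintro ⟨h, hpos⟩
    have h1 := map_mem_arrangements (f := (s * ·)) (fun a _ b _ hab => by
      rw [← hc a, ← hc b]; exact congrArg (s * ·) hab) h
    rwa [List.map_map, (List.map_congr_left fun a ha => by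
      rw [Function.comp_apply, abs_eq_mul_of_pos hs (hpos a ha), hc, id]).trans
        (List.map_id l)] at h1

theorem append_mem_arrangements {S T : Finset ℤ} (hTS : T ⊆ S) {l m : List ℤ}
    (hl : l ∈ arrangements T) (hm : m ∈ arrangements (S \ T)) : l ++ m ∈ arrangements S := by
  rw [mem_arrangements_iff] at hl hm ⊢
  obtain ⟨hl, rfl⟩ := hl
  obtain ⟨hm, hm'⟩ := hm
  refine ⟨List.nodup_append'.2 ⟨hl, hm, fun a ha hb => ?_⟩, ?_⟩
  · rw [← List.mem_toFinset, hm', Finset.mem_sdiff] at hb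
    exact hb.2 (List.mem_toFinset.2 ha)
  · rw [List.toFinset_append, hm', Finset.union_sdiff_of_subset hTS]

theorem mem_arrangements_of_append {S : Finset ℤ} {l m : List ℤ}
    (h : l ++ m ∈ arrangements S) :
    l.toFinset ⊆ S ∧ l ∈ arrangements l.toFinset ∧ m ∈ arrangements (S \ l.toFinset) := by
  obtain ⟨hn, rfl⟩ := mem_arrangements_iff.1 h
  obtain ⟨hl, hm, hd⟩ := List.nodup_append'.1 hn
  rw [List.toFinset_append]
  refine ⟨Finset.subset_union_left, mem_arrangements_iff.2 ⟨hl, rfl⟩,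
    mem_arrangements_iff.2 ⟨hm, ?_⟩⟩
  rw [Finset.union_sdiff_cancel_left]
  exact List.disjoint_toFinset_iff_disjoint.2 hd

/-- Signed arrangements are cut after their longest initial run of letters of sign `s`. -/
theorem sum_signedArrangements_split {M : Type*} [AddCommMonoid M] {U : Finset ℤ}
    (hU : ∀ a ∈ U, 0 < a) {s : ℤ} (hs : |s| = 1) (F : List ℤ → M) :
    ∑ l ∈ signedArrangements U, F l =
      ∑ T ∈ U.powerset, ∑ q ∈ arrangements (T.image (s * ·)) ×ˢ
        (signedArrangements (U \ T)).filter (fun m => ¬ 0 < s * m.headD 0), F (q.1 ++ q.2) := by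
  have hsub : ∀ T ⊆ U, ∀ a ∈ T, 0 < a := fun T hT a ha => hU a (hT ha)
  have hsd : ∀ T : Finset ℤ, ∀ a ∈ U \ T, 0 < a := fun T => hsub _ Finset.sdiff_subset
  rw [Finset.sum_sigma']
  refine Finset.sum_nbij'
    -- `T` is the set of absolute values of the run.
    (fun l => ⟨((l.takeWhile fun a => decide (0 < s * a)).map abs).toFinset,
      (l.takeWhile fun a => decide (0 < s * a), l.dropWhile fun a => decide (0 < s * a))⟩)
    (fun x => x.2.1 ++ x.2.2) ?_ ?_ ?_ ?_ ?_
  · intro l hl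
    rw [mem_signedArrangements hU,
      ← List.takeWhile_append_dropWhile (p := fun a => decide (0 < s * a)) (l := l),
      List.map_append] at hl
    obtain ⟨h1, h2, h3⟩ := mem_arrangements_of_append hl
    rw [Finset.mem_sigma, Finset.mem_product, Finset.mem_filter, Finset.mem_powerset]
    exact ⟨h1, (mem_arrangements_image_mul hs (hsub _ h1)).2
      ⟨h2, fun a ha => by simpa using List.mem_takeWhile_imp ha⟩,
      (mem_signedArrangements (hsd _)).2 h3, not_headD_dropWhile s l⟩
  · rintro ⟨T, l, m⟩ hx
    rw [Finset.mem_sigma, Finset.mem_product, Finset.mem_filter, Finset.mem_powerset] at hx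
    obtain ⟨hT, hl, hm, _⟩ := hx
    rw [mem_signedArrangements hU, List.map_append]
    exact append_mem_arrangements hT ((mem_arrangements_image_mul hs (hsub _ hT)).1 hl).1
      ((mem_signedArrangements (hsd _)).1 hm)
  · intro l _
    exact List.takeWhile_append_dropWhile
  · rintro ⟨T, l, m⟩ hx
    rw [Finset.mem_sigma, Finset.mem_product, Finset.mem_filter, Finset.mem_powerset] at hx
    obtain ⟨hT, hl, hm, hm'⟩ := hx
    obtain ⟨hl1, hl2⟩ := (mem_arrangements_image_mul hs (hsub _ hT)).1 hl
    obtain ⟨h1, h2⟩ := takeWhile_dropWhile_append hl2 hm'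
    simp only [h1, h2, (mem_arrangements_iff.1 hl1).2]
  · intro l _
    simp only [List.takeWhile_append_dropWhile]

/-! ### The two identities -/

theorem signedArrangements_empty : signedArrangements ∅ = {[]} := by
  refine Finset.eq_singleton_iff_unique_mem.2 ⟨?_, fun m hm => ?_⟩
  · exact (mem_signedArrangements (by simp)).2 (mem_arrangements_iff.2 ⟨List.nodup_nil, rfl⟩)
  · exact List.length_eq_zero_iff.1 (length_of_mem_signedArrangements (by simp) hm)

theorem two_pow_mul_eulerianA (n : ℕ) :
    (2 : ℤ[X]) ^ n * eulerianA n =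
      ∑ k ∈ Finset.range (n + 1), (n.choose k : ℤ[X]) * eulerianA k * flagE (n - k) := by
  have hU : ∀ a ∈ Finset.Icc 1 (n : ℤ), 0 < a := pos_of_mem_Icc_one
  have hcard : (Finset.Icc 1 (n : ℤ)).card = n := by simp
  have h := sum_signedArrangements hU
  -- `s = -1`: the initial run is negative.
  rw [hcard, sum_signedArrangements_split hU (s := -1) (by simp)] at h
  rw [← h, Finset.sum_congr rfl (g := fun T => eulerianA T.card * flagE (n - T.card)),
    Finset.sum_powerset_apply_card fun k => eulerianA k * flagE (n - k), hcard]
  · exact Finset.sum_congr rfl fun k _ => by rw [nsmul_eq_mul, mul_assoc]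
  · intro T hT
    rw [Finset.mem_powerset] at hT
    have hV : ∀ a ∈ Finset.Icc 1 (n : ℤ) \ T, 0 < a := fun a ha =>
      hU a (Finset.sdiff_subset ha)
    have hA := sum_arrangements (T.image ((-1 : ℤ) * ·))
    have hE := sum_filter_not_neg hV
    rw [Finset.card_image_of_injective _ (mul_right_injective₀ (by simp))] at hA
    rw [Finset.card_sdiff_of_subset hT, hcard] at hE
    rw [← hA, ← hE, Finset.sum_mul_sum, ← Finset.sum_product']
    simp only [neg_one_mul, Int.neg_pos]
    refine Finset.sum_congr rfl fun q hq => ?_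
    rw [Finset.mem_product, Finset.mem_filter] at hq
    rw [listDes_append_of_neg (fun a ha => ?_) hq.2.2, pow_add]
    obtain ⟨b, hb, rfl⟩ := Finset.mem_image.1 ((mem_of_mem_arrangements hq.1).1 ha)
    have := hU b (hT hb)
    omega

/-- Cutting a type `B` word after its longest initial run of positive letters, the run being an
arrangement of `T` and the rest a signed arrangement of `V`. -/
theorem sum_arrangements_product {T V : Finset ℤ} (hT : ∀ a ∈ T, 0 < a)
    (hV : ∀ a ∈ V, 0 < a) :
    ∑ q ∈ arrangements T ×ˢ (signedArrangements V).filter (fun m => ¬ 0 < m.headD 0),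
      (X : ℤ[X]) ^ listDes (0 :: (q.1 ++ q.2)) =
      eulerianA T.card * if V.card = 0 then 1 else X * flagO V.card := by
  have hpos : ∀ q ∈ arrangements T, ∀ a ∈ q, 0 < a := fun q hq a ha =>
    hT a ((mem_of_mem_arrangements hq).1 ha)
  rw [← sum_arrangements T, Finset.sum_product, Finset.sum_mul]
  refine Finset.sum_congr rfl fun q hq => ?_
  by_cases h0 : V.card = 0
  · obtain rfl := Finset.card_eq_zero.1 h0
    rw [signedArrangements_empty, Finset.filter_singleton, if_pos (by simp),
      Finset.sum_singleton, if_pos Finset.card_empty, List.append_nil, mul_one,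
      listDes_zero_cons_of_pos (hpos q hq)]
  · have hO := sum_filter_neg hV
    rw [if_neg h0, ← hO, Finset.mul_sum, Finset.mul_sum]
    -- As `V` is nonempty, so is the rest; its first letter is nonzero, so not positive means
    -- negative.
    have hne : ∀ m ∈ signedArrangements V,
        (¬ 0 < m.headD 0 ↔ m.headD 0 < 0) := by
      intro m hm
      cases m with
      | nil =>
        have := length_of_mem_signedArrangements hV hm
        exact absurd this.symm h0
      | cons a m =>
        have := abs_pos.1 (hV _ (abs_mem_of_mem_signedArrangements hV hm
          (List.mem_cons_self (a := a))))
        rw [List.headD_cons]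
        omega
    rw [Finset.filter_congr hne]
    refine Finset.sum_congr rfl fun m hm => ?_
    obtain ⟨_, hm⟩ := Finset.mem_filter.1 hm
    cases m with
    | nil => exact absurd hm (lt_irrefl _)
    | cons b m =>
      rw [List.headD_cons] at hm
      rw [listDes_cons_append_cons hm m q 0 le_rfl (hpos q hq),
        listDes_zero_cons_of_pos (hpos q hq), pow_add, pow_add, pow_one]

theorem eulerianB_eq (n : ℕ) :
    eulerianB n =
      eulerianA n +
        X * ∑ k ∈ Finset.range n, (n.choose k : ℤ[X]) * eulerianA k * flagO (n - k) := by
  have hU : ∀ a ∈ Finset.Icc 1 (n : ℤ), 0 < a := pos_of_mem_Icc_one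
  have hcard : (Finset.Icc 1 (n : ℤ)).card = n := by simp
  have h := sum_signedPerm_eq_sum_signedArrangements n fun l => (X : ℤ[X]) ^ listDes (0 :: l)
  simp only [listDes_zero_cons_wordList n _ (show signedWord _ 0 = 0 by simp [signedWord])] at h
  -- `s = 1`: the initial run is positive. The term `k = n`, where the rest is empty, is split off
  -- and gives `A_n`.
  rw [eulerianB, h, sum_signedArrangements_split hU (s := 1) (by simp),
    Finset.sum_congr rfl (g := fun T => eulerianA T.card *
      if n - T.card = 0 then 1 else X * flagO (n - T.card)),
    Finset.sum_powerset_apply_card fun k => eulerianA k *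
      if n - k = 0 then 1 else X * flagO (n - k), hcard, Finset.sum_range_succ, add_comm]
  · rw [Finset.mul_sum]
    refine congrArg₂ (· + ·) (by simp) ?_
    refine Finset.sum_congr rfl fun k hk => ?_
    rw [Finset.mem_range] at hk
    rw [if_neg (by omega), nsmul_eq_mul]
    ring
  · intro T hT
    rw [Finset.mem_powerset] at hT
    have hV : ∀ a ∈ Finset.Icc 1 (n : ℤ) \ T, 0 < a := fun a ha =>
      hU a (Finset.sdiff_subset ha)
    have hVc := Finset.card_sdiff_of_subset hT
    rw [hcard] at hVc
    have h1 := sum_arrangements_product (fun a ha => hU a (hT ha)) hV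
    rw [hVc] at h1
    simpa only [one_mul, Finset.image_id'] using h1

theorem mainTheorem7 (n : ℕ) :
    (2 : ℤ[X]) ^ n * eulerianA n =
        ∑ k ∈ Finset.range (n + 1), (n.choose k : ℤ[X]) * eulerianA k * flagE (n - k) ∧
      eulerianB n =
        eulerianA n +
          X * ∑ k ∈ Finset.range n, (n.choose k : ℤ[X]) * eulerianA k * flagO (n - k) :=
  ⟨two_pow_mul_eulerianA n, eulerianB_eq n⟩
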